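/- Let $0<\alpha<1$, let $b<X$ and let $y$ be a real-valued function on $[b,X]$. For $b\le x\le X$ let $$y^{(\alpha)}(x)=\frac{1}{\Gamma(1-\alpha)}\int_b^x\frac{y'(\xi)}{(x-\xi)^{\alpha}}\,d\xi$$ be the Caputo derivative of order $\alpha$ of $y$ with lower limit $b$, and for $h>0$ let $$\Delta_h^\alpha y(x)=\sum_{k=0}^{\lfloor (x-b)/h\rfloor}(-1)^k\binom{\alpha}{k}\,y(x-kh),\qquad \binom{\alpha}{k}=\frac{\alpha(\alpha-1)\cdots(\alpha-k+1)}{k!},$$ be the Grünwald difference operator. On the uniform grid $x_n=b+nh$ write $\Delta_h^\alpha y_n=\Delta_h^\alpha y(x_n)$ and $y_n^{(\alpha)}=y^{(\alpha)}(x_n)$. (i) Let $y(b)=y'(b)=y''(b)=0$ and $y\in C^4[b,X]$. Then $$h^{-\alpha}\Delta_h^\alpha y_n=\frac{\alpha}{2}\,y^{(\alpha)}_{n-1}+\Bigl(1-\frac{\alpha}{2}\Bigr)y^{(\alpha)}_n+O(h^2),$$ where the implied constant is the same for all $h>0$ and all integers $n\ge1$ with $x_n\le X$ (it may depend on $\alpha$,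 $b$, $X$ and $y$). (ii) Let $y(b)=y'(b)=y''(b)=y'''(b)=0$ and $y\in C^5[b,X]$. Then $$h^{-\alpha}\Delta_h^\alpha y_n=\Bigl(\frac{\alpha^2}{8}-\frac{5\alpha}{24}\Bigr)y^{(\alpha)}_{n-2}+\Bigl(\frac{11\alpha}{12}-\frac{\alpha^2}{4}\Bigr)y^{(\alpha)}_{n-1}+\Bigl(1-\frac{17\alpha}{24}+\frac{\alpha^2}{8}\Bigr)y^{(\alpha)}_n+O(h^3),$$ where the implied constant is the same for all $h>0$ and all integers $n\ge2$ with $x_n\le X$ (it may depend on $\alpha$, $b$, $X$ and $y$). -/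

import Mathlib

/-- The Caputo derivative of order `α`, `0 < α < 1`, with lower limit `b`:
`y^(α)(x) = 1 / Γ(1 - α) * ∫_b^x y'(ξ) / (x - ξ)^α dξ`. -/
noncomputable def caputoDeriv (α b : ℝ) (y : ℝ → ℝ) (x : ℝ) : ℝ :=
  1 / Real.Gamma (1 - α) * ∫ ξ in b..x, deriv y ξ / (x - ξ) ^ α

/-- The Grünwald weights `w_k = (-1)^k * binom(α, k)`, where `Ring.choose α k` is the
generalized binomial coefficient `α (α - 1) ⋯ (α - k + 1) / k!`. -/
noncomputable def grunwaldWeight (α : ℝ) (k : ℕ) : ℝ :=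
  (-1) ^ k * Ring.choose α k

/-- The Grünwald difference operator with lower limit `b` and step `h`:
`∑ w_k y(x - k h)`, summed over `0 ≤ k ≤ ⌊(x - b) / h⌋`. -/
noncomputable def grunwaldDiff (α b h : ℝ) (y : ℝ → ℝ) (x : ℝ) : ℝ :=
  ∑ k ∈ Finset.range (⌊(x - b) / h⌋₊ + 1), grunwaldWeight α k * y (x - k * h)

/-! The error is a Peano-kernel integral. Take m = 2 in (i), m = 3 in (ii), and g = y^(m+1). Since y
and its first m derivatives vanish at b, repeated integration by parts gives y(x) = ∫ g(s) (x-s)₊^m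
/ m! ds and y^(α)(x) = ∫ g(s) (x-s)₊^(m-α) / Γ(m+1-α) ds. By linearity and scaling, the error at x
equals h^(m-α) ∫_b^x g(s) K((x-s)/h) ds, where K is `grunwaldKernel` and does not depend on h. Once
|K(t)| ≤ C t^(-α) for all t > 0, the error is at most C h^m sup|g| ∫_b^x (x-s)^(-α) ds, and this
integral is bounded because α < 1.

The decay of K (`grunwaldKernel_isBigO_two`, `grunwaldKernel_isBigO_three`) carries the proof. Put n
= ⌊t⌋ and θ = t - n. The Grünwald sum in K is W_n = Σ_{k≤n} w_k times a polynomial in n and θ, and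
W_n = Γ(n+1-α) / (Γ(1-α) n!) has an expansion in powers of 1/n. Hence Γ(1-α) K(t) t^(α-m) expands in
powers of 1/t with coefficients polynomial in θ. Below order t^(-m) the θ-dependence cancels, and
what remains vanishes exactly when Σ a_j e^(-jz) agrees with ((1-e^(-z))/z)^α up to O(z^m): Σ a_j =
1, Σ j a_j = α/2 and, for m = 3, Σ j² a_j = (3α²+α)/12. -/

open Filter Topology Asymptotics

/-! ### Grünwald weights, their partial sums and moments. -/

theorem grunwaldWeight_zero (α : ℝ) : grunwaldWeight α 0 = 1 := by
  simp [grunwaldWeight]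

theorem grunwaldWeight_succ (α : ℝ) (k : ℕ) :
    grunwaldWeight α (k + 1) = grunwaldWeight α k * ((k - α) / (k + 1)) := by
  have hk : ((k : ℝ) + 1) ≠ 0 := by positivity
  have h : Ring.choose α (k + 1) = Ring.choose α k * ((α - k) / (k + 1)) := by
    rw [Ring.choose_eq_smul, Ring.choose_eq_smul, descPochhammer_succ_right]
    simp only [Polynomial.smeval_mul, Polynomial.smeval_sub, Polynomial.smeval_X,
      Polynomial.smeval_natCast, Nat.factorial_succ, smul_eq_mul]
    push_cast
    have := Nat.factorial_ne_zero k
    field_simp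
    simp
  rw [grunwaldWeight, grunwaldWeight, h, pow_succ]
  ring

/-- The partial sums of the Grünwald weights. -/
noncomputable def grunwaldSum (α : ℝ) (n : ℕ) : ℝ :=
  ∑ k ∈ Finset.range (n + 1), grunwaldWeight α k

/-- Lets every later quantity be factored through `grunwaldSum`, which satisfies a one-term
recursion. -/
theorem grunwaldWeight_succ_eq (α : ℝ) (n : ℕ) :
    grunwaldWeight α (n + 1) = -α / (n + 1) * grunwaldSum α n := by
  induction n with
  | zero => simp [grunwaldSum, grunwaldWeight_succ, grunwaldWeight_zero]
  | succ n ih =>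
    have h1 : ((n : ℝ) + 1) ≠ 0 := by positivity
    have h2 : ((n : ℝ) + 1 + 1) ≠ 0 := by positivity
    rw [grunwaldWeight_succ, grunwaldSum, Finset.sum_range_succ, ← grunwaldSum, ih]
    push_cast
    field_simp
    ring

theorem grunwaldSum_succ (α : ℝ) (n : ℕ) :
    grunwaldSum α (n + 1) = (n + 1 - α) / (n + 1) * grunwaldSum α n := by
  have h1 : ((n : ℝ) + 1) ≠ 0 := by positivity
  rw [grunwaldSum, Finset.sum_range_succ, ← grunwaldSum, grunwaldWeight_succ_eq]
  field_simp
  ring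

theorem grunwaldSum_zero (α : ℝ) : grunwaldSum α 0 = 1 := by
  simp [grunwaldSum, grunwaldWeight_zero]

theorem grunwaldSum_pos {α : ℝ} (hα : α < 1) (n : ℕ) : 0 < grunwaldSum α n := by
  induction n with
  | zero => simp [grunwaldSum_zero]
  | succ n ih =>
    rw [grunwaldSum_succ]
    have : (0 : ℝ) ≤ n := n.cast_nonneg
    have : 0 < (n : ℝ) + 1 - α := by linarith
    positivity

theorem prod_range_eq_factorial_mul_grunwaldSum (α : ℝ) (n : ℕ) :
    ∏ j ∈ Finset.range n, (1 - α + j) = n.factorial * grunwaldSum α n := by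
  induction n with
  | zero => simp [grunwaldSum_zero]
  | succ n ih =>
    rw [Finset.prod_range_succ, ih, grunwaldSum_succ, Nat.factorial_succ]
    push_cast
    field_simp
    ring

theorem sum_range_grunwaldWeight_mul_one {α : ℝ} (hα : α < 1) (n : ℕ) :
    ∑ k ∈ Finset.range (n + 1), grunwaldWeight α k * ((n : ℝ) - k)
      = grunwaldSum α n * (n / (1 - α)) := by
  have ha : 1 - α ≠ 0 := by linarith
  induction n with
  | zero => simp
  | succ n ih =>
    have h1 : ((n : ℝ) + 1) ≠ 0 := by positivity
    rw [Finset.sum_range_succ]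
    have : ∀ k ∈ Finset.range (n + 1), grunwaldWeight α k * (((n + 1 : ℕ) : ℝ) - k)
        = grunwaldWeight α k * ((n : ℝ) - k) + grunwaldWeight α k := by
      intro k _; push_cast; ring
    rw [Finset.sum_congr rfl this, Finset.sum_add_distrib, ih, ← grunwaldSum, grunwaldSum_succ]
    push_cast
    field_simp
    ring

theorem sum_range_grunwaldWeight_mul_sq {α : ℝ} (hα : α < 1) (n : ℕ) :
    ∑ k ∈ Finset.range (n + 1), grunwaldWeight α k * ((n : ℝ) - k) ^ 2
      = grunwaldSum α n * (n * (2 * n - α) / ((1 - α) * (2 - α))) := by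
  have ha : 1 - α ≠ 0 := by linarith
  have hb : 2 - α ≠ 0 := by linarith
  induction n with
  | zero => simp
  | succ n ih =>
    have h1 : ((n : ℝ) + 1) ≠ 0 := by positivity
    rw [Finset.sum_range_succ]
    have : ∀ k ∈ Finset.range (n + 1), grunwaldWeight α k * (((n + 1 : ℕ) : ℝ) - k) ^ 2
        = grunwaldWeight α k * ((n : ℝ) - k) ^ 2 + 2 * (grunwaldWeight α k * ((n : ℝ) - k))
          + grunwaldWeight α k := by
      intro k _; push_cast; ring
    rw [Finset.sum_congr rfl this, Finset.sum_add_distrib, Finset.sum_add_distrib,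
      ← Finset.mul_sum, ih, sum_range_grunwaldWeight_mul_one hα, ← grunwaldSum, grunwaldSum_succ]
    push_cast
    field_simp
    ring

/-- The sum is the coefficient of z^n in (1-z)^α · z(1+4z+z²)/(1-z)^4; the Eulerian numbers 1, 4, 1
give the three terms of the numerator. The induction expands (n+1-k)^3 around n-k and uses the lower
moments. -/
theorem sum_range_grunwaldWeight_mul_cube {α : ℝ} (hα : α < 1) (n : ℕ) :
    ∑ k ∈ Finset.range (n + 1), grunwaldWeight α k * ((n : ℝ) - k) ^ 3
      = grunwaldSum α n * ((n * (n + 1 - α) * (n + 2 - α) + 4 * n * (n - 1) * (n + 1 - α)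
          + n * (n - 1) * (n - 2)) / ((1 - α) * (2 - α) * (3 - α))) := by
  have ha : 1 - α ≠ 0 := by linarith
  have hb : 2 - α ≠ 0 := by linarith
  have hc : 3 - α ≠ 0 := by linarith
  induction n with
  | zero => simp
  | succ n ih =>
    have h1 : ((n : ℝ) + 1) ≠ 0 := by positivity
    rw [Finset.sum_range_succ]
    have : ∀ k ∈ Finset.range (n + 1), grunwaldWeight α k * (((n + 1 : ℕ) : ℝ) - k) ^ 3
        = grunwaldWeight α k * ((n : ℝ) - k) ^ 3 + 3 * (grunwaldWeight α k * ((n : ℝ) - k) ^ 2)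
          + 3 * (grunwaldWeight α k * ((n : ℝ) - k)) + grunwaldWeight α k := by
      intro k _; push_cast; ring
    rw [Finset.sum_congr rfl this, Finset.sum_add_distrib, Finset.sum_add_distrib,
      Finset.sum_add_distrib, ← Finset.mul_sum, ← Finset.mul_sum, ih,
      sum_range_grunwaldWeight_mul_sq hα, sum_range_grunwaldWeight_mul_one hα, ← grunwaldSum,
      grunwaldSum_succ]
    push_cast
    field_simp
    ring

/-- Used with n = ⌊t⌋ and θ = t - ⌊t⌋, so that n + θ = t. -/
theorem sum_range_grunwaldWeight_mul_add_sq {α : ℝ} (hα : α < 1) (n : ℕ) (θ : ℝ) :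
    ∑ k ∈ Finset.range (n + 1), grunwaldWeight α k * ((n : ℝ) + θ - k) ^ 2
      = grunwaldSum α n * (n * (2 * n - α) / ((1 - α) * (2 - α)) + 2 * θ * (n / (1 - α))
          + θ ^ 2) := by
  have : ∀ k ∈ Finset.range (n + 1), grunwaldWeight α k * ((n : ℝ) + θ - k) ^ 2
      = grunwaldWeight α k * ((n : ℝ) - k) ^ 2 + 2 * θ * (grunwaldWeight α k * ((n : ℝ) - k))
        + θ ^ 2 * grunwaldWeight α k := by
    intro k _; ring
  rw [Finset.sum_congr rfl this, Finset.sum_add_distrib, Finset.sum_add_distrib, ← Finset.mul_sum,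
    ← Finset.mul_sum, sum_range_grunwaldWeight_mul_sq hα, sum_range_grunwaldWeight_mul_one hα,
    ← grunwaldSum]
  ring

theorem sum_range_grunwaldWeight_mul_add_cube {α : ℝ} (hα : α < 1) (n : ℕ) (θ : ℝ) :
    ∑ k ∈ Finset.range (n + 1), grunwaldWeight α k * ((n : ℝ) + θ - k) ^ 3
      = grunwaldSum α n * ((n * (n + 1 - α) * (n + 2 - α) + 4 * n * (n - 1) * (n + 1 - α)
          + n * (n - 1) * (n - 2)) / ((1 - α) * (2 - α) * (3 - α))
          + 3 * θ * (n * (2 * n - α) / ((1 - α) * (2 - α))) + 3 * θ ^ 2 * (n / (1 - α))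
          + θ ^ 3) := by
  have : ∀ k ∈ Finset.range (n + 1), grunwaldWeight α k * ((n : ℝ) + θ - k) ^ 3
      = grunwaldWeight α k * ((n : ℝ) - k) ^ 3 + 3 * θ * (grunwaldWeight α k * ((n : ℝ) - k) ^ 2)
        + 3 * θ ^ 2 * (grunwaldWeight α k * ((n : ℝ) - k)) + θ ^ 3 * grunwaldWeight α k := by
    intro k _; ring
  rw [Finset.sum_congr rfl this, Finset.sum_add_distrib, Finset.sum_add_distrib,
    Finset.sum_add_distrib, ← Finset.mul_sum, ← Finset.mul_sum, ← Finset.mul_sum,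
    sum_range_grunwaldWeight_mul_cube hα,
    sum_range_grunwaldWeight_mul_sq hα, sum_range_grunwaldWeight_mul_one hα, ← grunwaldSum]
  ring

/-! ### Asymptotics of the partial sums. -/

/-- Euler's limit formula for Γ(1-α): its denominator is (n+1)! times `grunwaldSum α (n + 1)`.
Passing back to index n costs the factor (n+1-α)/n, whose logarithm tends to 0. -/
theorem tendsto_log_grunwaldSum {α : ℝ} (hα : α < 1) :
    Tendsto (fun n : ℕ => Real.log (grunwaldSum α n) + α * Real.log n) atTop
      (𝓝 (-Real.log (Real.Gamma (1 - α)))) := by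
  have hG := (Real.GammaSeq_tendsto_Gamma (1 - α)).log
    (Real.Gamma_pos_of_pos (by linarith)).ne'
  have hn : Tendsto (fun n : ℕ => Real.log ((n + 1 - α) / n)) atTop (𝓝 0) := by
    have h : Tendsto (fun n : ℕ => 1 + (1 - α) * (1 / (n : ℝ))) atTop (𝓝 (1 + (1 - α) * 0)) :=
      tendsto_const_nhds.add (tendsto_const_nhds.mul tendsto_one_div_atTop_nhds_zero_nat)
    have h' := h.log (by simp)
    rw [mul_zero, add_zero, Real.log_one] at h'
    refine h'.congr' ?_
    filter_upwards [eventually_gt_atTop 0] with n hn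
    have : (n : ℝ) ≠ 0 := by positivity
    congr 1
    field_simp
    ring
  have := hG.neg.sub hn
  rw [sub_zero] at this
  refine this.congr' ?_
  filter_upwards [eventually_gt_atTop 0] with n hn
  have h0 : (0 : ℝ) < n := by positivity
  have h1 : 0 < (n : ℝ) + 1 - α := by linarith
  have hW := grunwaldSum_pos hα n
  rw [Real.GammaSeq, prod_range_eq_factorial_mul_grunwaldSum, grunwaldSum_succ, Nat.factorial_succ,
    Real.log_div (by positivity) (by positivity), Real.log_mul (by positivity) (by positivity),
    Real.log_rpow h0, Real.log_div h1.ne' h0.ne']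
  push_cast
  have : (n + 1 : ℝ) * n.factorial * ((n + 1 - α) / (n + 1) * grunwaldSum α n)
      = n.factorial * ((n + 1 - α) * grunwaldSum α n) := by
    field_simp
  rw [this, Real.log_mul (by positivity) (by positivity), Real.log_mul (by positivity) (by positivity)]
  ring

theorem log_one_sub_add_sum_isBigO (k : ℕ) :
    (fun z : ℝ => Real.log (1 - z) + ∑ i ∈ Finset.range k, z ^ (i + 1) / (i + 1))
      =O[𝓝 0] fun z => z ^ (k + 1) := by
  refine IsBigO.of_bound 2 ?_
  filter_upwards [Metric.ball_mem_nhds (0 : ℝ) (by norm_num : (0 : ℝ) < 1 / 2)] with z hz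
  rw [mem_ball_zero_iff, Real.norm_eq_abs] at hz
  rw [add_comm, Real.norm_eq_abs, norm_pow, Real.norm_eq_abs]
  refine (Real.abs_log_sub_add_sum_range_le (by linarith) k).trans ?_
  rw [div_le_iff₀ (by linarith)]
  nlinarith [pow_nonneg (abs_nonneg z) (k + 1)]

/-- Telescoping to infinity: n^(-4) ≤ 3 (n^(-3) - (n+1)^(-3)), so the tail of the increments is
O(n^(-3)). -/
theorem isBigO_sub_limit_of_isBigO_succ_sub {L : ℕ → ℝ} {ℓ : ℝ} (hL : Tendsto L atTop (𝓝 ℓ))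
    (h : (fun n => L (n + 1) - L n) =O[atTop] fun n : ℕ => ((n : ℝ)⁻¹) ^ 4) :
    (fun n => L n - ℓ) =O[atTop] fun n : ℕ => ((n : ℝ)⁻¹) ^ 3 := by
  obtain ⟨K, hK⟩ := h.bound
  obtain ⟨N, hN⟩ := eventually_atTop.1 hK
  have hK0 : ∀ n : ℕ, N + 1 ≤ n →
      |L (n + 1) - L n| ≤ 3 * |K| * (((n : ℝ)⁻¹) ^ 3 - (((n + 1 : ℕ) : ℝ)⁻¹) ^ 3) := by
    intro n hn
    have hn1 : (1 : ℝ) ≤ n := by exact_mod_cast (by omega : 1 ≤ n)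
    have := hN n (by omega)
    rw [Real.norm_eq_abs, Real.norm_of_nonneg (by positivity)] at this
    refine this.trans ?_
    rw [mul_comm 3, mul_assoc]
    refine mul_le_mul (le_abs_self K) ?_ (by positivity) (abs_nonneg K)
    push_cast
    have e : 3 * (((n : ℝ)⁻¹) ^ 3 - (((n : ℝ) + 1)⁻¹) ^ 3) - ((n : ℝ)⁻¹) ^ 4
        = (8 * n ^ 3 + 6 * n ^ 2 - 1) / (n ^ 4 * (n + 1) ^ 3) := by
      field_simp
      ring
    have : 0 ≤ (8 * (n : ℝ) ^ 3 + 6 * n ^ 2 - 1) / (n ^ 4 * (n + 1) ^ 3) := by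
      apply div_nonneg
      · nlinarith [pow_nonneg (by linarith : (0 : ℝ) ≤ n) 3]
      · positivity
    linarith
  refine IsBigO.of_bound (3 * |K|) (eventually_atTop.2 ⟨N + 1, fun n hn => ?_⟩)
  have hm : ∀ m : ℕ, n ≤ m → |L m - L n| ≤ 3 * |K| * (((n : ℝ)⁻¹) ^ 3 - ((m : ℝ)⁻¹) ^ 3) := by
    intro m hm
    induction m, hm using Nat.le_induction with
    | base => simp
    | succ m hm ih =>
      have := hK0 m (by omega)
      have e : L (m + 1) - L n = (L (m + 1) - L m) + (L m - L n) := by ring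
      rw [e]
      refine (abs_add_le _ _).trans ?_
      linarith
  have hlim : Tendsto (fun m => |L m - L n|) atTop (𝓝 |ℓ - L n|) := (hL.sub_const _).abs
  have := le_of_tendsto hlim (b := 3 * |K| * ((n : ℝ)⁻¹) ^ 3)
    (eventually_atTop.2 ⟨n, fun m hnm => (hm m hnm).trans (by
      have : 0 ≤ 3 * |K| * ((m : ℝ)⁻¹) ^ 3 := by positivity
      nlinarith)⟩)
  rw [Real.norm_eq_abs, Real.norm_eq_abs, abs_of_nonneg (a := ((n : ℝ)⁻¹) ^ 3) (by positivity),
    abs_sub_comm]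
  exact this

/-- Asymptotic expansion of the logarithm of `∑_{k ≤ n} w_k = Γ(n + 1 - α) / (Γ(1 - α) n!)`. -/
theorem log_grunwaldSum_isBigO {α : ℝ} (hα : α < 1) :
    (fun n : ℕ => Real.log (grunwaldSum α n) + α * Real.log n
        - (α * (α - 1) / 2) * (n : ℝ)⁻¹ - (α * (α - 1) * (2 * α - 1) / 12) * ((n : ℝ)⁻¹) ^ 2
        - -Real.log (Real.Gamma (1 - α)))
      =O[atTop] fun n : ℕ => ((n : ℝ)⁻¹) ^ 3 := by
  have hx : Tendsto (fun n : ℕ => (n : ℝ)⁻¹) atTop (𝓝 0) := tendsto_inv_atTop_nhds_zero_nat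
  refine isBigO_sub_limit_of_isBigO_succ_sub ?_ ?_
  · have := ((tendsto_log_grunwaldSum hα).sub (hx.const_mul (α * (α - 1) / 2))).sub
      ((hx.pow 2).const_mul (α * (α - 1) * (2 * α - 1) / 12))
    simpa using this
  -- These values of u and v make the n^(-2) and n^(-3) terms of the increment cancel, leaving
  -- O(n^(-4)).
  · set u := α * (α - 1) / 2 with hu
    set v := α * (α - 1) * (2 * α - 1) / 12 with hv
    have h1 : ∀ β : ℝ, (fun n : ℕ => Real.log (1 - β * (n : ℝ)⁻¹)
        + ∑ i ∈ Finset.range 3, (β * (n : ℝ)⁻¹) ^ (i + 1) / (i + 1))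
        =O[atTop] fun n : ℕ => ((n : ℝ)⁻¹) ^ 4 := by
      intro β
      have ht : Tendsto (fun n : ℕ => β * (n : ℝ)⁻¹) atTop (𝓝 0) := by
        simpa using hx.const_mul β
      refine ((log_one_sub_add_sum_isBigO 3).comp_tendsto ht).trans ?_
      simp only [Function.comp_def, mul_pow]
      exact (isBigO_refl _ _).const_mul_left _
    have h2 : (fun n : ℕ => ((n : ℝ) + 1)⁻¹
        - ((n : ℝ)⁻¹ - ((n : ℝ)⁻¹) ^ 2 + ((n : ℝ)⁻¹) ^ 3)) =O[atTop]
          fun n : ℕ => ((n : ℝ)⁻¹) ^ 4 := by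
      refine IsBigO.of_bound 1 ?_
      filter_upwards [eventually_gt_atTop 0] with n hn
      have h0 : (0 : ℝ) < n := by positivity
      have e : ((n : ℝ) + 1)⁻¹ - ((n : ℝ)⁻¹ - ((n : ℝ)⁻¹) ^ 2 + ((n : ℝ)⁻¹) ^ 3)
          = -(((n : ℝ) + 1)⁻¹ * ((n : ℝ)⁻¹) ^ 3) := by
        field_simp
        ring
      rw [e, norm_neg, Real.norm_of_nonneg (by positivity), Real.norm_of_nonneg (by positivity),
        one_mul, pow_succ' _ 3]
      gcongr
      linarith
    have h3 : (fun n : ℕ => (((n : ℝ) + 1)⁻¹) ^ 2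
        - (((n : ℝ)⁻¹) ^ 2 - 2 * ((n : ℝ)⁻¹) ^ 3)) =O[atTop]
          fun n : ℕ => ((n : ℝ)⁻¹) ^ 4 := by
      refine IsBigO.of_bound 3 ?_
      filter_upwards [eventually_gt_atTop 0] with n hn
      have h0 : (0 : ℝ) < n := by positivity
      have h1 : (1 : ℝ) ≤ n := by exact_mod_cast hn
      have e : (((n : ℝ) + 1)⁻¹) ^ 2 - (((n : ℝ)⁻¹) ^ 2 - 2 * ((n : ℝ)⁻¹) ^ 3)
          = (3 * n + 2) / (n ^ 3 * (n + 1) ^ 2) := by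
        field_simp
        ring
      rw [e, Real.norm_of_nonneg (by positivity), Real.norm_of_nonneg (by positivity),
        div_le_iff₀ (by positivity)]
      field_simp
      nlinarith
    have key := ((((h1 (α - 1)).sub ((h1 (-1)).const_mul_left (1 - α))).sub
      (h2.const_mul_left u)).sub (h3.const_mul_left v))
    refine key.congr' ?_ EventuallyEq.rfl
    filter_upwards [eventually_gt_atTop 0] with n hn
    have h0 : (0 : ℝ) < n := by positivity
    have hW := grunwaldSum_pos hα n
    have e1 : (1 : ℝ) - (α - 1) * (n : ℝ)⁻¹ = (n + 1 - α) / n := by field_simp; ring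
    have e2 : (1 : ℝ) - -1 * (n : ℝ)⁻¹ = (n + 1) / n := by field_simp; ring
    have h4 : 0 < (n : ℝ) + 1 - α := by linarith
    rw [e1, e2, grunwaldSum_succ, Real.log_div h4.ne' h0.ne', Real.log_div (by positivity) h0.ne',
      Real.log_mul (by positivity) hW.ne', Real.log_div h4.ne' (by positivity)]
    simp only [Finset.sum_range_succ, Finset.sum_range_zero]
    push_cast
    rw [hu, hv]
    ring

/-! ### Calculus of second-order expansions in 1/t. -/

/-- `f t = a t + b t / t + c t / t ^ 2 + O(1 / t ^ 3)` as `t → ∞`, with bounded coefficients. -/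
structure HasInvExpansion (f a b c : ℝ → ℝ) : Prop where
  bdd₀ : a =O[atTop] fun _ => (1 : ℝ)
  bdd₁ : b =O[atTop] fun _ => (1 : ℝ)
  bdd₂ : c =O[atTop] fun _ => (1 : ℝ)
  isBigO : (fun t => f t - (a t + b t * t⁻¹ + c t * t⁻¹ ^ 2)) =O[atTop] fun t => t⁻¹ ^ 3

theorem inv_isBigO_one : (fun t : ℝ => t⁻¹) =O[atTop] fun _ => (1 : ℝ) :=
  tendsto_inv_atTop_zero.isBigO_one ℝ

theorem IsBigO.one_mul_one {l : Filter ℝ} {f g : ℝ → ℝ} (hf : f =O[l] fun _ => (1 : ℝ))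
    (hg : g =O[l] fun _ => (1 : ℝ)) : (fun t => f t * g t) =O[l] fun _ => (1 : ℝ) := by
  simpa using hf.mul hg

theorem IsBigO.one_pow {l : Filter ℝ} {f : ℝ → ℝ} (hf : f =O[l] fun _ => (1 : ℝ)) (k : ℕ) :
    (fun t => f t ^ k) =O[l] fun _ => (1 : ℝ) := by
  simpa using hf.pow k

namespace HasInvExpansion

variable {f g a b c a' b' c' : ℝ → ℝ}

theorem congr' (h : HasInvExpansion f a b c) (hf : f =ᶠ[atTop] g) :
    HasInvExpansion g a b c :=
  ⟨h.bdd₀, h.bdd₁, h.bdd₂, h.isBigO.congr' (hf.mono fun t ht => by simp only [ht])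
    EventuallyEq.rfl⟩

theorem coeff_congr (h : HasInvExpansion f a b c) (ha : ∀ t, a t = a' t) (hb : ∀ t, b t = b' t)
    (hc : ∀ t, c t = c' t) : HasInvExpansion f a' b' c' := by
  rw [funext ha, funext hb, funext hc] at h
  exact h

theorem poly_bdd (h : HasInvExpansion f a b c) :
    (fun t => a t + b t * t⁻¹ + c t * t⁻¹ ^ 2) =O[atTop] fun _ => (1 : ℝ) :=
  (h.bdd₀.add (IsBigO.one_mul_one h.bdd₁ inv_isBigO_one)).add
    (IsBigO.one_mul_one h.bdd₂ (IsBigO.one_pow inv_isBigO_one 2))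

theorem bdd (h : HasInvExpansion f a b c) : f =O[atTop] fun _ => (1 : ℝ) := by
  have h1 : (fun t : ℝ => t⁻¹ ^ 3) =O[atTop] fun _ => (1 : ℝ) := IsBigO.one_pow inv_isBigO_one 3
  simpa using (h.isBigO.trans h1).add h.poly_bdd

theorem add (hf : HasInvExpansion f a b c) (hg : HasInvExpansion g a' b' c') :
    HasInvExpansion (fun t => f t + g t) (fun t => a t + a' t) (fun t => b t + b' t)
      (fun t => c t + c' t) := by
  refine ⟨hf.bdd₀.add hg.bdd₀, hf.bdd₁.add hg.bdd₁, hf.bdd₂.add hg.bdd₂, ?_⟩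
  exact (hf.isBigO.add hg.isBigO).congr_left fun t => by ring

theorem const_mul (hf : HasInvExpansion f a b c) (k : ℝ) :
    HasInvExpansion (fun t => k * f t) (fun t => k * a t) (fun t => k * b t)
      (fun t => k * c t) := by
  refine ⟨hf.bdd₀.const_mul_left k, hf.bdd₁.const_mul_left k, hf.bdd₂.const_mul_left k, ?_⟩
  exact (hf.isBigO.const_mul_left k).congr_left fun t => by ring

theorem sub (hf : HasInvExpansion f a b c) (hg : HasInvExpansion g a' b' c') :
    HasInvExpansion (fun t => f t - g t) (fun t => a t - a' t) (fun t => b t - b' t)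
      (fun t => c t - c' t) := by
  refine ⟨hf.bdd₀.sub hg.bdd₀, hf.bdd₁.sub hg.bdd₁, hf.bdd₂.sub hg.bdd₂, ?_⟩
  exact (hf.isBigO.sub hg.isBigO).congr_left fun t => by ring

theorem mul (hf : HasInvExpansion f a b c) (hg : HasInvExpansion g a' b' c') :
    HasInvExpansion (fun t => f t * g t) (fun t => a t * a' t)
      (fun t => a t * b' t + b t * a' t) (fun t => a t * c' t + b t * b' t + c t * a' t) := by
  refine ⟨IsBigO.one_mul_one hf.bdd₀ hg.bdd₀,
    (IsBigO.one_mul_one hf.bdd₀ hg.bdd₁).add (IsBigO.one_mul_one hf.bdd₁ hg.bdd₀),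
    ((IsBigO.one_mul_one hf.bdd₀ hg.bdd₂).add (IsBigO.one_mul_one hf.bdd₁ hg.bdd₁)).add
      (IsBigO.one_mul_one hf.bdd₂ hg.bdd₀), ?_⟩
  have h1 := hf.isBigO.mul hg.bdd
  have h2 := hf.poly_bdd.mul hg.isBigO
  have h3 : (fun t => (b t * c' t + c t * b' t + c t * c' t * t⁻¹) * t⁻¹ ^ 3)
      =O[atTop] fun t => 1 * t⁻¹ ^ 3 :=
    (((IsBigO.one_mul_one hf.bdd₁ hg.bdd₂).add (IsBigO.one_mul_one hf.bdd₂ hg.bdd₁)).add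
      (IsBigO.one_mul_one (IsBigO.one_mul_one hf.bdd₂ hg.bdd₂) inv_isBigO_one)).mul
      (isBigO_refl _ _)
  simp only [mul_one, one_mul] at h1 h2 h3
  exact ((h1.add h2).add h3).congr_left fun t => by ring

theorem of_poly {a b c d : ℝ → ℝ} (ha : a =O[atTop] fun _ => (1 : ℝ))
    (hb : b =O[atTop] fun _ => (1 : ℝ)) (hc : c =O[atTop] fun _ => (1 : ℝ))
    (hd : d =O[atTop] fun _ => (1 : ℝ)) :
    HasInvExpansion (fun t => a t + b t * t⁻¹ + c t * t⁻¹ ^ 2 + d t * t⁻¹ ^ 3) a b c := by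
  refine ⟨ha, hb, hc, ?_⟩
  have h : (fun t => d t * t⁻¹ ^ 3) =O[atTop] fun t => 1 * t⁻¹ ^ 3 := hd.mul (isBigO_refl _ _)
  simp only [one_mul] at h
  exact h.congr_left fun t => by ring

/-- With no constant term f is O(1/t), so the exponential series may be cut after f²/2. -/
theorem exp (hf : HasInvExpansion f (fun _ => 0) b c) :
    HasInvExpansion (fun t => Real.exp (f t)) (fun _ => 1) b (fun t => c t + b t ^ 2 / 2) := by
  have hfx : f =O[atTop] fun t => t⁻¹ := by
    have h1 : (fun t : ℝ => t⁻¹ ^ 3) =O[atTop] fun t => t⁻¹ := by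
      have : (fun t : ℝ => t⁻¹ * t⁻¹ ^ 2) =O[atTop] fun t => t⁻¹ * 1 :=
        (isBigO_refl _ _).mul (IsBigO.one_pow inv_isBigO_one 2)
      simpa [pow_succ', mul_assoc] using this
    have h2 : (fun t => t⁻¹ * (b t + c t * t⁻¹)) =O[atTop] fun t => t⁻¹ * 1 :=
      (isBigO_refl _ _).mul (hf.bdd₁.add (IsBigO.one_mul_one hf.bdd₂ inv_isBigO_one))
    simp only [mul_one] at h2
    exact ((hf.isBigO.trans h1).add h2).congr_left fun t => by ring
  have h0 : Tendsto f atTop (𝓝 0) := hfx.trans_tendsto tendsto_inv_atTop_zero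
  have h3 := ((Real.exp_sub_sum_range_isBigO_pow 3).comp_tendsto h0).trans (hfx.pow 3)
  have hsq := (hf.mul hf).const_mul (1 / 2)
  have := (hf.add hsq).isBigO.add h3
  refine ⟨isBigO_refl _ _, hf.bdd₁, hf.bdd₂.add ?_, this.congr_left fun t => ?_⟩
  · simpa [div_eq_inv_mul] using (IsBigO.one_pow hf.bdd₁ 2).const_mul_left (2⁻¹)
  · simp [Finset.sum_range_succ]
    ring

theorem log_one_sub {δ : ℝ → ℝ} (hδ : δ =O[atTop] fun _ => (1 : ℝ)) :
    HasInvExpansion (fun t => Real.log (1 - δ t * t⁻¹)) (fun _ => 0) (fun t => -δ t)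
      (fun t => -(δ t ^ 2 / 2)) := by
  have hx : (fun t => δ t * t⁻¹) =O[atTop] fun t => t⁻¹ := by
    simpa using hδ.mul (isBigO_refl (fun t : ℝ => t⁻¹) atTop)
  have h0 : Tendsto (fun t => δ t * t⁻¹) atTop (𝓝 0) := hx.trans_tendsto tendsto_inv_atTop_zero
  have h3 := ((log_one_sub_add_sum_isBigO 2).comp_tendsto h0).trans (hx.pow 3)
  refine ⟨isBigO_zero _ _, hδ.neg_left, ?_, h3.congr_left fun t => ?_⟩
  · simpa [div_eq_inv_mul] using ((IsBigO.one_pow hδ 2).const_mul_left (2⁻¹)).neg_left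
  · simp [Finset.sum_range_succ]
    ring

end HasInvExpansion

/-! ### Expansions of the ingredients of the kernel. -/

theorem sub_floor_isBigO_one :
    (fun t : ℝ => t - (⌊t⌋₊ : ℝ)) =O[atTop] fun _ => (1 : ℝ) := by
  refine IsBigO.of_bound 1 ?_
  filter_upwards [eventually_ge_atTop 0] with t ht
  have h1 := Nat.floor_le ht
  have h2 := Nat.lt_floor_add_one t
  rw [Real.norm_eq_abs, abs_of_nonneg (by linarith)]
  simp
  linarith

theorem inv_floor_isBigO_inv : (fun t : ℝ => (⌊t⌋₊ : ℝ)⁻¹) =O[atTop] fun t => t⁻¹ := by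
  refine IsBigO.of_bound 2 ?_
  filter_upwards [eventually_ge_atTop 2] with t ht
  have h2 := Nat.lt_floor_add_one t
  have h3 : (0 : ℝ) < ⌊t⌋₊ := by linarith
  rw [Real.norm_of_nonneg (by positivity), Real.norm_of_nonneg (by positivity)]
  field_simp
  linarith

theorem hasInvExpansion_inv_floor :
    HasInvExpansion (fun t => (⌊t⌋₊ : ℝ)⁻¹) (fun _ => 0) (fun _ => 1)
      (fun t => t - (⌊t⌋₊ : ℝ)) := by
  refine ⟨isBigO_zero _ _, isBigO_refl _ _, sub_floor_isBigO_one, ?_⟩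
  -- With n = ⌊t⌋ and θ = t - n, the remainder 1/n - 1/t - θ/t² is exactly θ²/(n t²).
  have h := ((IsBigO.one_pow sub_floor_isBigO_one 2).mul inv_floor_isBigO_inv).mul
    ((isBigO_refl (fun t : ℝ => t⁻¹) atTop).pow 2)
  refine h.congr' ?_ (Eventually.of_forall fun t => by ring)
  filter_upwards [eventually_ge_atTop 2] with t ht
  have h2 := Nat.lt_floor_add_one t
  have h3 : (⌊t⌋₊ : ℝ) ≠ 0 := by linarith
  have h4 : t ≠ 0 := by linarith
  field_simp
  ring

/-- Exponentiate the expansion of log W_n + α log n + log Γ(1-α), rewritten in 1/t, minus α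
log(n/t), where n/t = 1 - θ/t. -/
theorem hasInvExpansion_grunwaldSum {α : ℝ} (hα : α < 1) :
    HasInvExpansion (fun t => grunwaldSum α ⌊t⌋₊ * Real.Gamma (1 - α) * t ^ α)
      (fun _ => 1) (fun t => α * (t - ⌊t⌋₊) + α * (α - 1) / 2)
      (fun t => α * (t - ⌊t⌋₊) ^ 2 / 2 + α * (α - 1) / 2 * (t - ⌊t⌋₊)
        + α * (α - 1) * (2 * α - 1) / 12
        + (α * (t - ⌊t⌋₊) + α * (α - 1) / 2) ^ 2 / 2) := by
  have hΓ : 0 < Real.Gamma (1 - α) := Real.Gamma_pos_of_pos (by linarith)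
  have h1 := ((log_grunwaldSum_isBigO hα).comp_tendsto
    (tendsto_nat_floor_atTop (α := ℝ))).trans (inv_floor_isBigO_inv.pow 3)
  have h1' : HasInvExpansion _ (fun _ => 0) (fun _ => 0) (fun _ => 0) :=
    ⟨isBigO_zero _ _, isBigO_zero _ _, isBigO_zero _ _, h1.congr_left fun t => by
      rw [zero_mul, zero_mul, add_zero, add_zero, sub_zero]⟩
  have h2 := hasInvExpansion_inv_floor.const_mul (α * (α - 1) / 2)
  have h3 := (hasInvExpansion_inv_floor.mul hasInvExpansion_inv_floor).const_mul
    (α * (α - 1) * (2 * α - 1) / 12)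
  have h4 := (HasInvExpansion.log_one_sub sub_floor_isBigO_one).const_mul α
  have h5 := ((h1'.add h2).add h3).sub h4
  have h6 := (h5.coeff_congr (a' := fun _ => 0)
    (b' := fun t => α * (t - ⌊t⌋₊) + α * (α - 1) / 2)
    (c' := fun t => α * (t - ⌊t⌋₊) ^ 2 / 2 + α * (α - 1) / 2 * (t - ⌊t⌋₊)
        + α * (α - 1) * (2 * α - 1) / 12)
    (fun t => by ring) (fun t => by ring) (fun t => by ring)).exp
  refine h6.congr' ?_
  filter_upwards [eventually_ge_atTop 2] with t ht
  have h7 := Nat.lt_floor_add_one t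
  have h8 : (0 : ℝ) < ⌊t⌋₊ := by linarith
  have h9 : 0 < t := by linarith
  have hW := grunwaldSum_pos hα ⌊t⌋₊
  have e : 1 - (t - ⌊t⌋₊) * t⁻¹ = ⌊t⌋₊ / t := by field_simp; ring
  have h10 : 0 < grunwaldSum α ⌊t⌋₊ * Real.Gamma (1 - α) * t ^ α := by positivity
  rw [← Real.exp_log h10]
  congr 1
  rw [e, Real.log_mul (by positivity) (by positivity), Real.log_mul hW.ne' hΓ.ne',
    Real.log_div h8.ne' h9.ne', Real.log_rpow h9, Function.comp_apply]
  ring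

theorem hasInvExpansion_sub_rpow (α s : ℝ) :
    HasInvExpansion (fun t => (t - s) ^ (-α) * t ^ α) (fun _ => 1) (fun _ => α * s)
      (fun _ => α * (α + 1) / 2 * s ^ 2) := by
  have h := (HasInvExpansion.log_one_sub (isBigO_const_const s (one_ne_zero (α := ℝ)) _)).const_mul
    (-α)
  have h' := (h.coeff_congr (a' := fun _ => 0) (b' := fun t => α * s)
    (c' := fun t => α * s ^ 2 / 2)
    (fun t => by ring) (fun t => by ring) (fun t => by ring)).exp
  refine (h'.coeff_congr (fun t => rfl) (fun t => rfl)
    (c' := fun _ => α * (α + 1) / 2 * s ^ 2) (fun t => by ring)).congr' ?_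
  filter_upwards [eventually_gt_atTop 0, eventually_gt_atTop s] with t h0 hs
  have h1 : 0 < t - s := by linarith
  have e : 1 - s * t⁻¹ = (t - s) / t := by field_simp
  rw [e, Real.log_div h1.ne' h0.ne', Real.rpow_def_of_pos h1, Real.rpow_def_of_pos h0,
    ← Real.exp_add]
  congr 1
  ring

theorem const_isBigO_one (k : ℝ) : (fun _ : ℝ => k) =O[atTop] fun _ => (1 : ℝ) :=
  isBigO_const_const k one_ne_zero _

theorem hasInvExpansion_sub_rpow_nat (α s : ℝ) {m : ℕ} {p q r : ℝ}
    (h : HasInvExpansion (fun t => ((t - s) / t) ^ m) (fun _ => p) (fun _ => q) (fun _ => r)) :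
    HasInvExpansion (fun t => max (t - s) 0 ^ (m - α) * t ^ (α - m)) (fun _ => p)
      (fun _ => α * s * p + q) (fun _ => α * (α + 1) / 2 * s ^ 2 * p + α * s * q + r) := by
  refine (((hasInvExpansion_sub_rpow α s).mul h).coeff_congr (fun t => by ring) (fun t => by ring)
    (fun t => by ring)).congr' ?_
  filter_upwards [eventually_gt_atTop 0, eventually_gt_atTop s] with t h0 hs
  have h1 : 0 < t - s := by linarith
  rw [max_eq_left h1.le, sub_eq_add_neg (m : ℝ), add_comm (m : ℝ), Real.rpow_add h1,
    Real.rpow_sub h0, Real.rpow_natCast, Real.rpow_natCast, div_pow]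
  field_simp

theorem hasInvExpansion_sub_div_sq (s : ℝ) :
    HasInvExpansion (fun t => ((t - s) / t) ^ 2) (fun _ => 1) (fun _ => -2 * s)
      (fun _ => s ^ 2) := by
  refine (HasInvExpansion.of_poly (const_isBigO_one 1) (const_isBigO_one (-2 * s))
    (const_isBigO_one (s ^ 2)) (const_isBigO_one 0)).congr' ?_
  filter_upwards [eventually_gt_atTop 0] with t h0
  field_simp
  ring

theorem hasInvExpansion_sub_div_cube (s : ℝ) :
    HasInvExpansion (fun t => ((t - s) / t) ^ 3) (fun _ => 1) (fun _ => -3 * s)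
      (fun _ => 3 * s ^ 2) := by
  refine (HasInvExpansion.of_poly (const_isBigO_one 1) (const_isBigO_one (-3 * s))
    (const_isBigO_one (3 * s ^ 2)) (const_isBigO_one (-s ^ 3))).congr' ?_
  filter_upwards [eventually_gt_atTop 0] with t h0
  field_simp
  ring

/-! ### Decay of the Peano kernel. -/

/-- Up to the factor `h ^ (m - α)`, the error of approximating `h ^ (-α)` times the Grünwald
difference by `∑ a_j y^(α)(x - j h)` for the truncated power `(x - s)₊ ^ m / m!`, at
`t = (x - s) / h`. -/
noncomputable def grunwaldKernel (α : ℝ) (m : ℕ) (a : ℕ → ℝ) (q : ℕ) (t : ℝ) : ℝ :=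
  (∑ k ∈ Finset.range (⌊t⌋₊ + 1), grunwaldWeight α k * (t - k) ^ m) / m.factorial
    - (∑ j ∈ Finset.range q, a j * max (t - j) 0 ^ (m - α)) / Real.Gamma (m + 1 - α)

theorem Real.Gamma_three_sub {α : ℝ} (hα : α < 1) :
    Real.Gamma (3 - α) = (2 - α) * (1 - α) * Real.Gamma (1 - α) := by
  rw [show (3 - α) = (1 - α) + 1 + 1 by ring, Real.Gamma_add_one (by linarith),
    Real.Gamma_add_one (by linarith)]
  ring

theorem Real.Gamma_four_sub {α : ℝ} (hα : α < 1) :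
    Real.Gamma (4 - α) = (3 - α) * (2 - α) * (1 - α) * Real.Gamma (1 - α) := by
  rw [show (4 - α) = (3 - α) + 1 by ring, Real.Gamma_add_one (by linarith),
    Real.Gamma_three_sub hα]
  ring

theorem poly_sub_floor_isBigO_one (c₀ c₁ c₂ c₃ : ℝ) :
    (fun t : ℝ => c₀ + c₁ * (t - ⌊t⌋₊) + c₂ * (t - ⌊t⌋₊) ^ 2 + c₃ * (t - ⌊t⌋₊) ^ 3)
      =O[atTop] fun _ => (1 : ℝ) :=
  (((const_isBigO_one c₀).add (sub_floor_isBigO_one.const_mul_left c₁)).add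
    ((IsBigO.one_pow sub_floor_isBigO_one 2).const_mul_left c₂)).add
    ((IsBigO.one_pow sub_floor_isBigO_one 3).const_mul_left c₃)

theorem HasInvExpansion.isBigO_sq {f c : ℝ → ℝ}
    (h : HasInvExpansion f (fun _ => 0) (fun _ => 0) c) : f =O[atTop] fun t => t⁻¹ ^ 2 := by
  have h1 : (fun t : ℝ => t⁻¹ * t⁻¹ ^ 2) =O[atTop] fun t => 1 * t⁻¹ ^ 2 :=
    inv_isBigO_one.mul (isBigO_refl _ _)
  have h2 : (fun t : ℝ => c t * t⁻¹ ^ 2) =O[atTop] fun t => 1 * t⁻¹ ^ 2 :=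
    h.bdd₂.mul (isBigO_refl _ _)
  simp only [one_mul, ← pow_succ'] at h1 h2
  exact ((h.isBigO.trans h1).add h2).congr_left fun t => by ring

theorem HasInvExpansion.isBigO_cube {f : ℝ → ℝ}
    (h : HasInvExpansion f (fun _ => 0) (fun _ => 0) (fun _ => 0)) :
    f =O[atTop] fun t => t⁻¹ ^ 3 :=
  h.isBigO.congr_left fun t => by ring

theorem isBigO_rpow_neg_of_isBigO_inv_pow {α : ℝ} {m : ℕ} {f g : ℝ → ℝ} {Γ : ℝ} (hΓ : Γ ≠ 0)
    (hf : f =O[atTop] fun t => t⁻¹ ^ m)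
    (hg : ∀ᶠ t in atTop, f t = Γ * g t * t ^ (α - m)) :
    g =O[atTop] fun t => t ^ (-α) := by
  have := (hf.mul (isBigO_refl (fun t : ℝ => t ^ (m - α)) atTop)).const_mul_left Γ⁻¹
  refine this.congr' ?_ ?_
  · filter_upwards [hg, eventually_gt_atTop 0] with t ht h0
    rw [ht, mul_assoc _ (t ^ (α - m)), ← Real.rpow_add h0]
    simp
    field_simp
  · filter_upwards [eventually_gt_atTop 0] with t h0
    rw [sub_eq_add_neg, Real.rpow_add h0, Real.rpow_natCast, inv_pow]
    field_simp

theorem grunwaldKernel_isBigO_two {α : ℝ} (hα : α < 1) {a : ℕ → ℝ} (h0 : a 0 = 1 - α / 2)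
    (h1 : a 1 = α / 2) :
    grunwaldKernel α 2 a 2 =O[atTop] fun t => t ^ (-α) := by
  have hΓ : Real.Gamma (1 - α) ≠ 0 := (Real.Gamma_pos_of_pos (by linarith)).ne'
  have ha : 1 - α ≠ 0 := by linarith
  have hb : 2 - α ≠ 0 := by linarith
  -- The second-moment formula divided by 2! t², with n = t - θ substituted.
  have hP := HasInvExpansion.of_poly
    (poly_sub_floor_isBigO_one (1 / ((1 - α) * (2 - α))) 0 0 0)
    (poly_sub_floor_isBigO_one (-α / (2 * (1 - α) * (2 - α)))
      (1 / (1 - α) - 2 / ((1 - α) * (2 - α))) 0 0)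
    (poly_sub_floor_isBigO_one 0 (α / (2 * (1 - α) * (2 - α)))
      (1 / ((1 - α) * (2 - α)) - 1 / (1 - α) + 1 / 2) 0)
    (const_isBigO_one 0)
  have hS := fun s : ℝ => hasInvExpansion_sub_rpow_nat α s (hasInvExpansion_sub_div_sq s)
  have hmain := ((hasInvExpansion_grunwaldSum hα).mul hP).sub
    ((((hS 0).const_mul (a 0)).add ((hS 1).const_mul (a 1))).const_mul
      (1 / ((1 - α) * (2 - α))))
  -- For m = 2 only the first two coefficients need to vanish: O(t^(-2)) times t^(2-α) is already
  -- O(t^(-α)).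
  have hzero := (hmain.coeff_congr (a' := fun _ => 0) (b' := fun _ => 0)
    (fun t => by rw [h0, h1]; field_simp; ring)
    (fun t => by rw [h0, h1]; field_simp; ring) (fun t => rfl)).isBigO_sq
  refine isBigO_rpow_neg_of_isBigO_inv_pow (α := α) hΓ hzero ?_
  filter_upwards [eventually_gt_atTop 0] with t ht
  have hF := sum_range_grunwaldWeight_mul_add_sq hα ⌊t⌋₊ (t - ⌊t⌋₊)
  rw [add_sub_cancel] at hF
  have hG := Real.Gamma_three_sub hα
  have hα' : t ^ α = t ^ (α - (2 : ℕ)) * t ^ 2 := by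
    rw [Real.rpow_sub ht, Real.rpow_natCast]
    field_simp
  rw [grunwaldKernel, hF, Finset.sum_range_succ, Finset.sum_range_succ, Finset.sum_range_zero,
    show ((2 : ℕ) : ℝ) + 1 - α = 3 - α by push_cast; ring, hG, hα']
  push_cast
  generalize max (t - 0) 0 ^ (2 - α) = R₀
  generalize max (t - 1) 0 ^ (2 - α) = R₁
  generalize t ^ (α - 2) = T
  generalize (⌊t⌋₊ : ℝ) = n
  simp only [Nat.factorial]
  push_cast
  field_simp
  ring

theorem grunwaldKernel_isBigO_three {α : ℝ} (hα : α < 1) {a : ℕ → ℝ}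
    (h0 : a 0 = 1 - 17 * α / 24 + α ^ 2 / 8) (h1 : a 1 = 11 * α / 12 - α ^ 2 / 4)
    (h2 : a 2 = α ^ 2 / 8 - 5 * α / 24) :
    grunwaldKernel α 3 a 3 =O[atTop] fun t => t ^ (-α) := by
  have hΓ : Real.Gamma (1 - α) ≠ 0 := (Real.Gamma_pos_of_pos (by linarith)).ne'
  have ha : 1 - α ≠ 0 := by linarith
  have hb : 2 - α ≠ 0 := by linarith
  have hc : 3 - α ≠ 0 := by linarith
  -- The third-moment formula divided by 3! t³, with n = t - θ; its t^(-3) term goes into the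
  -- remainder.
  have hP := HasInvExpansion.of_poly
    (poly_sub_floor_isBigO_one (1 / ((1 - α) * (2 - α) * (3 - α))) 0 0 0)
    (poly_sub_floor_isBigO_one (-α / ((1 - α) * (2 - α) * (3 - α)))
      (1 / ((1 - α) * (2 - α)) - 3 / ((1 - α) * (2 - α) * (3 - α))) 0 0)
    (poly_sub_floor_isBigO_one (α * (1 + α) / (6 * (1 - α) * (2 - α) * (3 - α)))
      (2 * α / ((1 - α) * (2 - α) * (3 - α)) - α / (2 * (1 - α) * (2 - α)))
      (3 / ((1 - α) * (2 - α) * (3 - α)) - 2 / ((1 - α) * (2 - α)) + 1 / (2 * (1 - α))) 0)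
    (poly_sub_floor_isBigO_one 0 (-(α * (1 + α) / (6 * (1 - α) * (2 - α) * (3 - α))))
      (α / (2 * (1 - α) * (2 - α)) - α / ((1 - α) * (2 - α) * (3 - α)))
      (1 / ((1 - α) * (2 - α)) - 1 / ((1 - α) * (2 - α) * (3 - α)) - 1 / (2 * (1 - α)) + 1 / 6))
  have hS := fun s : ℝ => hasInvExpansion_sub_rpow_nat α s (hasInvExpansion_sub_div_cube s)
  have hmain := ((hasInvExpansion_grunwaldSum hα).mul hP).sub
    (((((hS 0).const_mul (a 0)).add ((hS 1).const_mul (a 1))).add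
      ((hS 2).const_mul (a 2))).const_mul (1 / ((1 - α) * (2 - α) * (3 - α))))
  have hzero := (hmain.coeff_congr (a' := fun _ => 0) (b' := fun _ => 0) (c' := fun _ => 0)
    (fun t => by rw [h0, h1, h2]; field_simp; ring)
    (fun t => by rw [h0, h1, h2]; field_simp; ring)
    (fun t => by rw [h0, h1, h2]; field_simp; ring)).isBigO_cube
  refine isBigO_rpow_neg_of_isBigO_inv_pow (α := α) hΓ hzero ?_
  filter_upwards [eventually_gt_atTop 0] with t ht
  have hF := sum_range_grunwaldWeight_mul_add_cube hα ⌊t⌋₊ (t - ⌊t⌋₊)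
  rw [add_sub_cancel] at hF
  have hG := Real.Gamma_four_sub hα
  have hα' : t ^ α = t ^ (α - (3 : ℕ)) * t ^ 3 := by
    rw [Real.rpow_sub ht, Real.rpow_natCast]
    field_simp
  rw [grunwaldKernel, hF, Finset.sum_range_succ, Finset.sum_range_succ, Finset.sum_range_succ,
    Finset.sum_range_zero, show ((3 : ℕ) : ℝ) + 1 - α = 4 - α by push_cast; ring, hG, hα']
  push_cast
  generalize max (t - 0) 0 ^ (3 - α) = R₀
  generalize max (t - 1) 0 ^ (3 - α) = R₁
  generalize max (t - 2) 0 ^ (3 - α) = R₂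
  generalize t ^ (α - 3) = T
  generalize (⌊t⌋₊ : ℝ) = n
  simp only [Nat.factorial]
  push_cast
  field_simp
  ring

/-- The asymptotic bound covers t ≥ T; on (0, T] the kernel is bounded by M, and t^(-α) ≥ T^(-α)
there. -/
theorem exists_abs_grunwaldKernel_le {α : ℝ} (hα0 : 0 < α) (hα : α < 1) {m : ℕ} (hm : 1 ≤ m)
    {a : ℕ → ℝ} {q : ℕ} (h : grunwaldKernel α m a q =O[atTop] fun t => t ^ (-α)) :
    ∃ C, 0 ≤ C ∧ ∀ t, 0 < t → |grunwaldKernel α m a q t| ≤ C * t ^ (-α) := by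
  obtain ⟨K, hK⟩ := h.bound
  obtain ⟨N, hN⟩ := eventually_atTop.1 hK
  set T := max N 1 with hT
  have hT1 : 1 ≤ T := le_max_right _ _
  have hmα : 0 ≤ (m : ℝ) - α := by
    have : (1 : ℝ) ≤ m := by exact_mod_cast hm
    linarith
  have hΓ : 0 < Real.Gamma (m + 1 - α) := Real.Gamma_pos_of_pos (by linarith)
  set M := (∑ k ∈ Finset.range (⌊T⌋₊ + 1), |grunwaldWeight α k| * T ^ m) / m.factorial
    + (∑ j ∈ Finset.range q, |a j| * T ^ (m - α)) / Real.Gamma (m + 1 - α) with hM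
  have hM0 : 0 ≤ M := by positivity
  refine ⟨|K| + M * T ^ α, by positivity, fun t ht => ?_⟩
  have htα : 0 < t ^ (-α) := Real.rpow_pos_of_pos ht _
  rcases le_total T t with hTt | hTt
  · have := hN t ((le_max_left _ _).trans hTt)
    rw [Real.norm_eq_abs, Real.norm_of_nonneg htα.le] at this
    refine this.trans (mul_le_mul_of_nonneg_right ?_ htα.le)
    have : 0 ≤ M * T ^ α := by positivity
    linarith [le_abs_self K]
  · have hle : |grunwaldKernel α m a q t| ≤ M := by
      rw [grunwaldKernel]
      refine (abs_sub _ _).trans (add_le_add ?_ ?_)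
      · rw [abs_div, abs_of_pos (by positivity : (0 : ℝ) < m.factorial)]
        refine div_le_div_of_nonneg_right ((Finset.abs_sum_le_sum_abs _ _).trans ?_)
          (by positivity)
        refine (Finset.sum_le_sum fun k hk => ?_).trans (Finset.sum_le_sum_of_subset_of_nonneg
          (Finset.range_mono (Nat.succ_le_succ (Nat.floor_mono hTt)))
          fun k _ _ => (by positivity : 0 ≤ |grunwaldWeight α k| * T ^ m))
        have hk' : (k : ℝ) ≤ t := (Nat.le_floor_iff ht.le).1
          (Nat.lt_succ_iff.1 (Finset.mem_range.1 hk))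
        have hk0 : (0 : ℝ) ≤ k := k.cast_nonneg
        rw [abs_mul, abs_pow, abs_of_nonneg (by linarith : 0 ≤ t - k)]
        gcongr
        linarith
      · rw [abs_div, abs_of_pos hΓ]
        refine div_le_div_of_nonneg_right ((Finset.abs_sum_le_sum_abs _ _).trans ?_) hΓ.le
        refine Finset.sum_le_sum fun j _ => ?_
        rw [abs_mul, abs_of_nonneg (Real.rpow_nonneg (le_max_right _ _) _)]
        gcongr
        have : (0 : ℝ) ≤ j := j.cast_nonneg
        exact max_le (by linarith) (by linarith)
    have h1 : 1 ≤ T ^ α * t ^ (-α) := by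
      rw [Real.rpow_neg ht.le, ← div_eq_mul_inv, one_le_div (by positivity)]
      exact Real.rpow_le_rpow ht.le hTt hα0.le
    calc |grunwaldKernel α m a q t| ≤ M * 1 := by simpa using hle
      _ ≤ M * (T ^ α * t ^ (-α)) := by gcongr
      _ ≤ (|K| + M * T ^ α) * t ^ (-α) := by
        have : 0 ≤ |K| * t ^ (-α) := by positivity
        linarith

/-! ### Riemann–Liouville integrals and the Peano representations. -/

theorem intervalIntegrable_sub_rpow {b x γ : ℝ} (hγ : -1 < γ) :
    IntervalIntegrable (fun s => (x - s) ^ γ) MeasureTheory.volume b x := by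
  have h := (intervalIntegral.intervalIntegrable_rpow' (a := x - b) (b := 0) hγ).comp_sub_left x
  simpa using h

theorem integral_sub_rpow {b x γ : ℝ} (hγ : -1 < γ) :
    ∫ s in b..x, (x - s) ^ γ = (x - b) ^ (γ + 1) / (γ + 1) := by
  rw [intervalIntegral.integral_comp_sub_left (fun s => s ^ γ) x, sub_self,
    integral_rpow (Or.inl hγ), Real.zero_rpow (by linarith), sub_zero]

/-- Integration by parts for a Riemann–Liouville integral. -/
theorem integral_mul_sub_rpow_div_Gamma {f f' : ℝ → ℝ} {b x γ : ℝ} (hγ : -1 < γ) (hbx : b ≤ x)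
    (hf : ContinuousOn f (Set.Icc b x)) (hf' : ContinuousOn f' (Set.Icc b x))
    (hd : ∀ s ∈ Set.Ioo b x, HasDerivAt f (f' s) s) (h0 : f b = 0) :
    (∫ s in b..x, f s * (x - s) ^ γ) / Real.Gamma (γ + 1)
      = (∫ s in b..x, f' s * (x - s) ^ (γ + 1)) / Real.Gamma (γ + 1 + 1) := by
  have hγ1 : 0 < γ + 1 := by linarith
  have hv : ContinuousOn (fun s => -((x - s) ^ (γ + 1) / (γ + 1))) (Set.uIcc b x) := by
    refine ContinuousOn.neg (ContinuousOn.div_const (ContinuousOn.rpow_const ?_ ?_) _)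
    · fun_prop
    · intro s _
      exact Or.inr hγ1.le
  have hvd : ∀ s ∈ Set.Ioo (min b x) (max b x),
      HasDerivAt (fun s => -((x - s) ^ (γ + 1) / (γ + 1))) ((x - s) ^ γ) s := by
    intro s hs
    rw [min_eq_left hbx, max_eq_right hbx] at hs
    have h1 : x - s ≠ 0 := by linarith [hs.2]
    have h2 := ((((hasDerivAt_id s).const_sub x).rpow_const (p := γ + 1) (Or.inl h1)).div_const
      (γ + 1)).neg
    refine h2.congr_deriv ?_
    rw [add_sub_cancel_right, id]
    field_simp
  have key := intervalIntegral.integral_mul_deriv_eq_deriv_mul_of_hasDerivAt (u := f) (u' := f')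
    (by rwa [Set.uIcc_of_le hbx]) hv (by rwa [min_eq_left hbx, max_eq_right hbx]) hvd
    (ContinuousOn.intervalIntegrable (by rwa [Set.uIcc_of_le hbx]))
    (intervalIntegrable_sub_rpow hγ)
  rw [key, h0, sub_self, Real.zero_rpow hγ1.ne', Real.Gamma_add_one hγ1.ne']
  have e : ∀ s, f' s * -((x - s) ^ (γ + 1) / (γ + 1))
      = -(1 / (γ + 1)) * (f' s * (x - s) ^ (γ + 1)) := by
    intro s; ring
  simp_rw [e]
  rw [intervalIntegral.integral_const_mul]
  have := (Real.Gamma_pos_of_pos hγ1).ne'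
  field_simp
  ring

section ContDiff

variable {y : ℝ → ℝ} {b X : ℝ} {m : ℕ}

theorem hasDerivAt_iteratedDerivWithin_Icc (hbX : b < X)
    (hy : ContDiffOn ℝ (m + 1 : ℕ) y (Set.Icc b X)) {k : ℕ} (hk : k ≤ m) {s : ℝ}
    (hs : s ∈ Set.Ioo b X) :
    HasDerivAt (iteratedDerivWithin k y (Set.Icc b X))
      (iteratedDerivWithin (k + 1) y (Set.Icc b X) s) s := by
  have h1 := hy.differentiableOn_iteratedDerivWithin (m := k)
    (by exact_mod_cast Nat.lt_succ_of_le hk) (uniqueDiffOn_Icc hbX)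
  have h2 := (h1 s (Set.Ioo_subset_Icc_self hs)).hasDerivWithinAt
  rw [← iteratedDerivWithin_succ] at h2
  exact h2.hasDerivAt (Icc_mem_nhds hs.1 hs.2)

theorem continuousOn_iteratedDerivWithin_Icc (hbX : b < X)
    (hy : ContDiffOn ℝ (m + 1 : ℕ) y (Set.Icc b X)) {k : ℕ} (hk : k ≤ m + 1) :
    ContinuousOn (iteratedDerivWithin k y (Set.Icc b X)) (Set.Icc b X) :=
  hy.continuousOn_iteratedDerivWithin (by exact_mod_cast hk) (uniqueDiffOn_Icc hbX)

/-- Serves both representations: γ = -α gives the Caputo derivative, γ = 0 gives y itself by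
Taylor's formula. -/
theorem integral_iteratedDerivWithin_mul_sub_rpow (hbX : b < X)
    (hy : ContDiffOn ℝ (m + 1 : ℕ) y (Set.Icc b X))
    (h0 : ∀ k : ℕ, k ≤ m → iteratedDerivWithin k y (Set.Icc b X) b = 0) {γ : ℝ} (hγ : -1 < γ)
    {x : ℝ} (hbx : b ≤ x) (hxX : x ≤ X) {j : ℕ} (hj : j ≤ m) :
    (∫ s in b..x, iteratedDerivWithin 1 y (Set.Icc b X) s * (x - s) ^ γ) / Real.Gamma (γ + 1)
      = (∫ s in b..x, iteratedDerivWithin (j + 1) y (Set.Icc b X) s * (x - s) ^ (γ + j))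
        / Real.Gamma (γ + j + 1) := by
  induction j with
  | zero => simp
  | succ j ih =>
    have hsub : Set.Icc b x ⊆ Set.Icc b X := Set.Icc_subset_Icc_right hxX
    have hj0 : (0 : ℝ) ≤ j := j.cast_nonneg
    rw [ih (by omega), integral_mul_sub_rpow_div_Gamma (by linarith) hbx
      ((continuousOn_iteratedDerivWithin_Icc hbX hy (by omega)).mono hsub)
      ((continuousOn_iteratedDerivWithin_Icc hbX hy (k := j + 1 + 1) (by omega)).mono hsub)
      (fun s hs => hasDerivAt_iteratedDerivWithin_Icc hbX hy hj ⟨hs.1, hs.2.trans_le hxX⟩)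
      (h0 _ hj)]
    push_cast
    simp only [add_assoc]

/-- Truncated powers put all shifted nodes x - kh under an integral over one common interval. -/
theorem integral_mul_max_sub_rpow {g : ℝ → ℝ} {x x' p : ℝ} (hp : 0 < p)
    (hg : ContinuousOn g (Set.Icc b X)) (hbx : b ≤ x) (hxx' : x ≤ x') (hx'X : x' ≤ X) :
    ∫ s in b..x', g s * max (x - s) 0 ^ p = ∫ s in b..x, g s * (x - s) ^ p := by
  have hcont : ContinuousOn (fun s => g s * max (x - s) 0 ^ p) (Set.Icc b X) :=
    hg.mul (ContinuousOn.rpow_const (by fun_prop) fun _ _ => Or.inr hp.le)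
  rw [← intervalIntegral.integral_add_adjacent_intervals (b := x)
    (ContinuousOn.intervalIntegrable (hcont.mono ?_))
    (ContinuousOn.intervalIntegrable (hcont.mono ?_))]
  · rw [show ∫ s in x..x', g s * max (x - s) 0 ^ p = 0 from ?_, add_zero]
    · refine intervalIntegral.integral_congr fun s hs => ?_
      rw [Set.uIcc_of_le hbx] at hs
      rw [max_eq_left (by linarith [hs.2])]
    · refine (intervalIntegral.integral_congr (g := fun _ => 0) fun s hs => ?_).trans
        intervalIntegral.integral_zero
      rw [Set.uIcc_of_le hxx'] at hs
      simp only
      rw [max_eq_right (by linarith [hs.1]), Real.zero_rpow hp.ne', mul_zero]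
  · rw [Set.uIcc_of_le hbx]
    exact Set.Icc_subset_Icc_right (by linarith)
  · rw [Set.uIcc_of_le hxx']
    exact Set.Icc_subset_Icc hbx hx'X

theorem caputoDeriv_eq_integral (hbX : b < X) (hm : 1 ≤ m)
    (hy : ContDiffOn ℝ (m + 1 : ℕ) y (Set.Icc b X))
    (h0 : ∀ k : ℕ, k ≤ m → iteratedDerivWithin k y (Set.Icc b X) b = 0) {α : ℝ} (hα : α < 1)
    {x x' : ℝ} (hbx : b ≤ x) (hxx' : x ≤ x') (hx'X : x' ≤ X) :
    caputoDeriv α b y x = (∫ s in b..x', iteratedDerivWithin (m + 1) y (Set.Icc b X) s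
      * max (x - s) 0 ^ (m - α)) / Real.Gamma (m + 1 - α) := by
  have hm' : (1 : ℝ) ≤ m := by exact_mod_cast hm
  rw [integral_mul_max_sub_rpow (by linarith)
    (continuousOn_iteratedDerivWithin_Icc hbX hy le_rfl) hbx hxx' hx'X]
  have h := integral_iteratedDerivWithin_mul_sub_rpow hbX hy h0 (γ := -α) (by linarith) hbx
    (hxx'.trans hx'X) le_rfl
  rw [show -α + m = m - α by ring, show m - α + 1 = m + 1 - α by ring,
    show -α + 1 = 1 - α by ring] at h
  rw [← h, caputoDeriv, one_div, inv_mul_eq_div]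
  congr 1
  refine intervalIntegral.integral_congr_ae ?_
  -- The point s = x must be dropped: if x = X, `deriv y` there need not be the derivative within
  -- the interval.
  have hne : ∀ᵐ s : ℝ, s ≠ x := by simp [MeasureTheory.ae_iff]
  filter_upwards [hne] with s hsx hs
  rw [Set.uIoc_of_le hbx] at hs
  have hs' : s < x := lt_of_le_of_ne hs.2 hsx
  rw [iteratedDerivWithin_one, derivWithin_of_mem_nhds
    (Icc_mem_nhds hs.1 (hs'.trans_le (hxx'.trans hx'X))), Real.rpow_neg (by linarith),
    div_eq_mul_inv]

theorem eq_integral_iteratedDerivWithin (hbX : b < X) (hm : 1 ≤ m)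
    (hy : ContDiffOn ℝ (m + 1 : ℕ) y (Set.Icc b X))
    (h0 : ∀ k : ℕ, k ≤ m → iteratedDerivWithin k y (Set.Icc b X) b = 0)
    {x x' : ℝ} (hbx : b ≤ x) (hxx' : x ≤ x') (hx'X : x' ≤ X) :
    y x = (∫ s in b..x', iteratedDerivWithin (m + 1) y (Set.Icc b X) s
      * max (x - s) 0 ^ m) / m.factorial := by
  have hm' : (0 : ℝ) < m := by exact_mod_cast hm
  have h1 := integral_mul_max_sub_rpow hm'
    (continuousOn_iteratedDerivWithin_Icc hbX hy le_rfl) hbx hxx' hx'X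
  simp_rw [Real.rpow_natCast] at h1
  have h := integral_iteratedDerivWithin_mul_sub_rpow hbX hy h0 (γ := 0) (by norm_num) hbx
    (hxx'.trans hx'X) le_rfl
  simp only [zero_add, Real.rpow_natCast, Real.rpow_zero, mul_one, Real.Gamma_one, div_one,
    Real.Gamma_nat_eq_factorial] at h
  rw [h1, ← h]
  have hsub : Set.Icc b x ⊆ Set.Icc b X := Set.Icc_subset_Icc_right (hxx'.trans hx'X)
  rw [intervalIntegral.integral_eq_sub_of_hasDerivAt_of_le hbx
    ((continuousOn_iteratedDerivWithin_Icc hbX hy (k := 0) (by omega)).mono hsub)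
    (fun s hs => hasDerivAt_iteratedDerivWithin_Icc hbX hy (k := 0) (by omega)
      ⟨hs.1, hs.2.trans_le (hxx'.trans hx'X)⟩)
    (ContinuousOn.intervalIntegrable (by
      rw [Set.uIcc_of_le hbx]
      exact (continuousOn_iteratedDerivWithin_Icc hbX hy (k := 1) (by omega)).mono hsub)),
    h0 0 (by omega)]
  simp

end ContDiff

/-! ### Scaling and the error estimate. -/

/-- Homogeneity of truncated powers; terms with r/h < k ≤ n vanish, so the range of summation no
longer depends on r. -/
theorem rpow_mul_grunwaldKernel_div {α : ℝ} {m : ℕ} (hm : 1 ≤ m) {a : ℕ → ℝ} {q n : ℕ}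
    {h r : ℝ} (hh : 0 < h) (hr : 0 ≤ r) (hrn : r ≤ n * h) :
    h ^ (m - α) * grunwaldKernel α m a q (r / h)
      = h ^ (-α) * ((∑ k ∈ Finset.range (n + 1),
          grunwaldWeight α k * max (r - k * h) 0 ^ m) / m.factorial)
        - (∑ j ∈ Finset.range q, a j * max (r - j * h) 0 ^ (m - α))
          / Real.Gamma (m + 1 - α) := by
  have hmax : ∀ k : ℕ, max (r - k * h) 0 = h * max (r / h - k) 0 := by
    intro k
    rw [mul_max_of_nonneg _ _ hh.le, mul_zero]
    congr 1
    field_simp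
  have hfl : ⌊r / h⌋₊ ≤ n := Nat.floor_le_of_le ((div_le_iff₀ hh).2 hrn)
  have hsum : ∑ k ∈ Finset.range (⌊r / h⌋₊ + 1), grunwaldWeight α k * (r / h - k) ^ m
      = ∑ k ∈ Finset.range (n + 1), grunwaldWeight α k * max (r / h - k) 0 ^ m := by
    have h1 : ∑ k ∈ Finset.range (⌊r / h⌋₊ + 1), grunwaldWeight α k * (r / h - k) ^ m
        = ∑ k ∈ Finset.range (⌊r / h⌋₊ + 1), grunwaldWeight α k * max (r / h - k) 0 ^ m := by
      refine Finset.sum_congr rfl fun k hk => ?_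
      have hk' : (k : ℝ) ≤ r / h := (Nat.le_floor_iff (by positivity)).1
        (Nat.lt_succ_iff.1 (Finset.mem_range.1 hk))
      rw [max_eq_left (by linarith)]
    rw [h1]
    refine Finset.sum_subset (Finset.range_mono (Nat.succ_le_succ hfl)) fun k _ hk => ?_
    have hk' : r / h < k := (Nat.floor_lt (by positivity)).1
      (by simpa [Nat.succ_le_iff] using hk)
    rw [max_eq_right (by linarith), zero_pow (by omega), mul_zero]
  rw [grunwaldKernel, hsum, mul_sub, mul_div_assoc', mul_div_assoc', mul_div_assoc',
    Finset.mul_sum, Finset.mul_sum, Finset.mul_sum]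
  congr 2
  · refine Finset.sum_congr rfl fun k _ => ?_
    rw [hmax, mul_pow, sub_eq_add_neg, add_comm, Real.rpow_add hh, Real.rpow_natCast]
    ring
  · refine Finset.sum_congr rfl fun k _ => ?_
    rw [hmax, Real.mul_rpow hh.le (le_max_right _ _)]
    ring

theorem exists_abs_grunwaldDiff_sub_sum_caputoDeriv_le {α : ℝ} (hα0 : 0 < α) (hα : α < 1)
    {b X : ℝ} (hbX : b < X) {y : ℝ → ℝ} {m : ℕ} (hm : 1 ≤ m)
    (hy : ContDiffOn ℝ (m + 1 : ℕ) y (Set.Icc b X))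
    (h0 : ∀ k : ℕ, k ≤ m → iteratedDerivWithin k y (Set.Icc b X) b = 0)
    {a : ℕ → ℝ} {q : ℕ} (hK : grunwaldKernel α m a q =O[atTop] fun t => t ^ (-α)) :
    ∃ C : ℝ, ∀ (h : ℝ) (n : ℕ), 0 < h → q ≤ n + 1 → b + n * h ≤ X →
      |h ^ (-α) * grunwaldDiff α b h y (b + n * h)
        - ∑ j ∈ Finset.range q, a j * caputoDeriv α b y (b + ((n : ℝ) - j) * h)|
        ≤ C * h ^ m := by
  obtain ⟨C, hC0, hC⟩ := exists_abs_grunwaldKernel_le hα0 hα hm hK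
  set g := iteratedDerivWithin (m + 1) y (Set.Icc b X) with hg
  have hgc : ContinuousOn g (Set.Icc b X) := continuousOn_iteratedDerivWithin_Icc hbX hy le_rfl
  obtain ⟨M, hM⟩ := isCompact_Icc.exists_bound_of_continuousOn hgc
  have hM0 : 0 ≤ M := (norm_nonneg _).trans (hM b (Set.left_mem_Icc.2 hbX.le))
  have hm' : (1 : ℝ) ≤ m := by exact_mod_cast hm
  -- M bounds |y^(m+1)|, C comes from the kernel, and the last factor is ∫_b^X (X-s)^(-α) ds.
  refine ⟨M * C * ((X - b) ^ (-α + 1) / (-α + 1)), fun h n hh hqn hnX => ?_⟩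
  set x := b + n * h with hx
  have hbx : b ≤ x := by have : 0 ≤ n * h := by positivity
                         linarith
  have hint : ∀ (p : ℝ), 0 ≤ p → ∀ z : ℝ,
      IntervalIntegrable (fun s => g s * max (z - s) 0 ^ p) MeasureTheory.volume b x := by
    intro p hp z
    refine ContinuousOn.intervalIntegrable ?_
    rw [Set.uIcc_of_le hbx]
    exact (hgc.mono (Set.Icc_subset_Icc_right hnX)).mul
      (ContinuousOn.rpow_const (by fun_prop) fun _ _ => Or.inr hp)
  have hfloor : ⌊(x - b) / h⌋₊ = n := by
    rw [hx, add_sub_cancel_left, mul_div_cancel_right₀ _ hh.ne', Nat.floor_natCast]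
  have hdiff : grunwaldDiff α b h y x = ∫ s in b..x, g s *
      ((∑ k ∈ Finset.range (n + 1), grunwaldWeight α k * max (x - s - k * h) 0 ^ m)
        / m.factorial) := by
    have e : ∀ s, g s * ((∑ k ∈ Finset.range (n + 1),
        grunwaldWeight α k * max (x - s - k * h) 0 ^ m) / m.factorial)
        = ∑ k ∈ Finset.range (n + 1), (grunwaldWeight α k / m.factorial)
          * (g s * max (x - k * h - s) 0 ^ (m : ℝ)) := by
      intro s
      rw [Finset.sum_div, Finset.mul_sum]
      refine Finset.sum_congr rfl fun k _ => ?_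
      rw [Real.rpow_natCast, sub_right_comm]
      ring
    simp_rw [e]
    rw [intervalIntegral.integral_finsetSum
      fun k _ => (hint m (by linarith) _).const_mul _, grunwaldDiff, hfloor]
    refine Finset.sum_congr rfl fun k hk => ?_
    have hk' : (k : ℝ) ≤ n := by exact_mod_cast Nat.lt_succ_iff.1 (Finset.mem_range.1 hk)
    have hk1 : (k : ℝ) * h ≤ n * h := by gcongr
    have hk2 : 0 ≤ (k : ℝ) * h := by positivity
    rw [intervalIntegral.integral_const_mul,
      eq_integral_iteratedDerivWithin hbX hm hy h0 (x' := x) (by linarith) (by linarith) hnX]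
    simp_rw [Real.rpow_natCast]
    ring
  have hcap : ∑ j ∈ Finset.range q, a j * caputoDeriv α b y (b + ((n : ℝ) - j) * h)
      = ∫ s in b..x, g s * ((∑ j ∈ Finset.range q, a j * max (x - s - j * h) 0 ^ (m - α))
        / Real.Gamma (m + 1 - α)) := by
    have e : ∀ s, g s * ((∑ j ∈ Finset.range q, a j * max (x - s - j * h) 0 ^ (m - α))
        / Real.Gamma (m + 1 - α))
        = ∑ j ∈ Finset.range q, (a j / Real.Gamma (m + 1 - α))
          * (g s * max (x - j * h - s) 0 ^ (m - α)) := by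
      intro s
      rw [Finset.sum_div, Finset.mul_sum]
      refine Finset.sum_congr rfl fun k _ => ?_
      rw [sub_right_comm]
      ring
    simp_rw [e]
    rw [intervalIntegral.integral_finsetSum
      fun k _ => (hint (m - α) (by linarith) _).const_mul _]
    -- Here q ≤ n + 1 keeps every node x - jh, j < q, at or to the right of b.
    refine Finset.sum_congr rfl fun j hj => ?_
    have hj' : (j : ℝ) ≤ n := by
      have := Finset.mem_range.1 hj
      exact_mod_cast (by omega : j ≤ n)
    have hk1 : (j : ℝ) * h ≤ n * h := by gcongr
    have hk2 : 0 ≤ (j : ℝ) * h := by positivity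
    rw [intervalIntegral.integral_const_mul, show b + ((n : ℝ) - j) * h = x - j * h by
      rw [hx]; ring,
      caputoDeriv_eq_integral hbX hm hy h0 hα (x' := x) (by linarith) (by linarith) hnX]
    ring
  have hgx : ContinuousOn g (Set.uIcc b x) := by
    rw [Set.uIcc_of_le hbx]
    exact hgc.mono (Set.Icc_subset_Icc_right hnX)
  rw [hdiff, hcap, ← intervalIntegral.integral_const_mul, ← intervalIntegral.integral_sub]
  rotate_left
  · refine ContinuousOn.intervalIntegrable (continuousOn_const.mul (hgx.mul ?_))
    fun_prop
  · refine ContinuousOn.intervalIntegrable (hgx.mul (ContinuousOn.div_const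
      (continuousOn_finsetSum _ fun j _ => continuousOn_const.mul
        (ContinuousOn.rpow_const (by fun_prop) fun _ _ => Or.inr (by linarith))) _))
  have hbound : ‖∫ s in b..x, (h ^ (-α) * (g s * ((∑ k ∈ Finset.range (n + 1),
      grunwaldWeight α k * max (x - s - k * h) 0 ^ m) / m.factorial))
      - g s * ((∑ j ∈ Finset.range q, a j * max (x - s - j * h) 0 ^ (m - α))
        / Real.Gamma (m + 1 - α)))‖ ≤ ∫ s in b..x, M * C * h ^ m * (x - s) ^ (-α) := by
    refine intervalIntegral.norm_integral_le_of_norm_le hbx ?_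
      ((intervalIntegrable_sub_rpow (by linarith)).const_mul _)
    have hne : ∀ᵐ s : ℝ, s ≠ x := by simp [MeasureTheory.ae_iff]
    filter_upwards [hne] with s hsx hs
    have hs' : s < x := lt_of_le_of_ne hs.2 hsx
    have hxs : 0 < x - s := by linarith
    have hker := rpow_mul_grunwaldKernel_div (α := α) (a := a) (q := q) hm hh hxs.le
      (n := n) (by linarith [hs.1])
    have e : ∀ A B G c : ℝ, c * (G * A) - G * B = G * (c * A - B) := fun A B G c => by ring
    rw [e, ← hker, norm_mul, norm_mul, Real.norm_of_nonneg (Real.rpow_nonneg hh.le _)]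
    have h1 := hM s ⟨hs.1.le, hs.2.trans hnX⟩
    have h2 := hC ((x - s) / h) (by positivity)
    rw [← Real.norm_eq_abs] at h2
    calc ‖g s‖ * (h ^ (m - α) * ‖grunwaldKernel α m a q ((x - s) / h)‖)
        ≤ M * (h ^ (m - α) * (C * ((x - s) / h) ^ (-α))) := by gcongr
      _ = M * C * h ^ m * (x - s) ^ (-α) := by
        rw [Real.div_rpow hxs.le hh.le, sub_eq_add_neg, Real.rpow_add hh, Real.rpow_natCast]
        field_simp
  rw [Real.norm_eq_abs, intervalIntegral.integral_const_mul,
    integral_sub_rpow (by linarith)] at hbound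
  refine hbound.trans ?_
  have h1 : (x - b) ^ (-α + 1) / (-α + 1) ≤ (X - b) ^ (-α + 1) / (-α + 1) := by
    have h2 : 0 < -α + 1 := by linarith
    have h3 : 0 ≤ x - b := by linarith
    gcongr
  calc M * C * h ^ m * ((x - b) ^ (-α + 1) / (-α + 1))
      ≤ M * C * h ^ m * ((X - b) ^ (-α + 1) / (-α + 1)) := by gcongr
    _ = M * C * ((X - b) ^ (-α + 1) / (-α + 1)) * h ^ m := by ring

theorem corollary5 (α : ℝ) (hα0 : 0 < α) (hα1 : α < 1) (b X : ℝ) (hbX : b < X) (y : ℝ → ℝ) :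
    (ContDiffOn ℝ 4 y (Set.Icc b X) →
      (∀ k : ℕ, k ≤ 2 → iteratedDerivWithin k y (Set.Icc b X) b = 0) →
      ∃ C : ℝ, ∀ (h : ℝ) (n : ℕ), 0 < h → 1 ≤ n → b + n * h ≤ X →
        |h ^ (-α) * grunwaldDiff α b h y (b + n * h)
          - ((α / 2) * caputoDeriv α b y (b + ((n : ℝ) - 1) * h)
            + (1 - α / 2) * caputoDeriv α b y (b + n * h))| ≤ C * h ^ 2) ∧
    (ContDiffOn ℝ 5 y (Set.Icc b X) →
      (∀ k : ℕ, k ≤ 3 → iteratedDerivWithin k y (Set.Icc b X) b = 0) →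
      ∃ C : ℝ, ∀ (h : ℝ) (n : ℕ), 0 < h → 2 ≤ n → b + n * h ≤ X →
        |h ^ (-α) * grunwaldDiff α b h y (b + n * h)
          - ((α ^ 2 / 8 - 5 * α / 24) * caputoDeriv α b y (b + ((n : ℝ) - 2) * h)
            + (11 * α / 12 - α ^ 2 / 4) * caputoDeriv α b y (b + ((n : ℝ) - 1) * h)
            + (1 - 17 * α / 24 + α ^ 2 / 8) * caputoDeriv α b y (b + n * h))|
          ≤ C * h ^ 3) := by
  refine ⟨fun hy h0 => ?_, fun hy h0 => ?_⟩
  -- Only j = 0, 1 enter the sum, so the `else` value is the coefficient for j = 1; in the second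
  -- case it is the one for j = 2.
  · obtain ⟨C, hC⟩ := exists_abs_grunwaldDiff_sub_sum_caputoDeriv_le hα0 hα1 hbX (m := 2)
      (by norm_num) (hy.of_le (by norm_num)) h0 (grunwaldKernel_isBigO_two hα1
        (a := fun j => if j = 0 then 1 - α / 2 else α / 2) rfl rfl)
    refine ⟨C, fun h n hh hn hX => (le_of_eq ?_).trans (hC h n hh (by omega) hX)⟩
    simp [Finset.sum_range_succ]
    congr 1
    ring
  · obtain ⟨C, hC⟩ := exists_abs_grunwaldDiff_sub_sum_caputoDeriv_le hα0 hα1 hbX (m := 3)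
      (by norm_num) (hy.of_le (by norm_num)) h0 (grunwaldKernel_isBigO_three hα1
        (a := fun j => if j = 0 then 1 - 17 * α / 24 + α ^ 2 / 8 else
          if j = 1 then 11 * α / 12 - α ^ 2 / 4 else α ^ 2 / 8 - 5 * α / 24) rfl rfl rfl)
    refine ⟨C, fun h n hh hn hX => (le_of_eq ?_).trans (hC h n hh (by omega) hX)⟩
    simp [Finset.sum_range_succ]
    congr 1
    ring
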